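/- Let $v$ be a Krull valuation of a field $K$, written additively, with value group $G_v$, valuation ring $R_v$ and maximal ideal $M_v$. For $h=\sum_i c_i x^i\in K[x]$ put $v^x(h)=\min_i v(c_i)$ (so $v^x(0)=\infty$). Let $\phi(x)\in R_v[x]$ be a monic polynomial of degree $m$ whose reduction modulo $M_v$ is irreducible over $R_v/M_v$. Let $f(x)\in R_v[x]$ be a polynomial not divisible by $\phi(x)$, with $\phi$-expansion $f=\sum_{i=0}^{n}a_i(x)\phi(x)^i$, where $\deg a_i<m$ and $a_n\neq 0$. Assume that $v^x(a_0)\neq 0$, that $v^x(a_j)=0$ for some $j$, and let $s$ be the smallest such $j$; assume also that $a_i\neq 0$ for some $i<s$. The $\phi$-Newton polygon of $f$ is defined as follows. For $0\le i<j\le n$ with $a_{n-i},a_{n-j}\neq0$ put $$\mu_{ij}=\frac{v^x(a_{n-j})-v^x(a_{n-i})}{j-i}$$ in the divisible closure of $G_v$. Let $i_0=0$ and, as long as $i_t<n$, let $i_{t+1}$ be the largest index $j$ with $i_t<j\le n$, $a_{n-j}\ne0$ for which $\mu_{i_tj}$ is minimal among all such $j$; the process stops with $i_q=n$. The polygon has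 $q$ edges; the $(t+1)$-st edge has vertices $(i_t,v^x(a_{n-i_t}))$ and $(i_{t+1},v^x(a_{n-i_{t+1}}))$ and slope $\mu_{i_ti_{t+1}}$. Assume that this polygon has exactly $l$ edges with positive slope, that their slopes are $\lambda_l<\cdots<\lambda_1$, and that the edge of slope $\lambda_j$ has vertices $(n-k_j,v^x(a_{k_j}))$ and $(n-k_{j-1},v^x(a_{k_{j-1}}))$ for $1\le j\le l$, where $0=k_0<k_1<\cdots<k_l=s\le n$ are integers. For $1\le j\le l$ let $\mathfrak d_j$ be the smallest positive integer such that $\mathfrak d_j\lambda_j\in G_v$. Then for every factorization $f=f_1f_2$ with $f_1,f_2\in K[x]$, $$\min\{\deg f_1,\deg f_2\}\le \deg f-\max_{1\le j\le l}\{\mathfrak d_j m\}.$$ -/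

import Mathlib

open Polynomial

noncomputable section

namespace KrullNewton

variable {K Γ : Type*} [Field K] [AddCommGroup Γ] [LinearOrder Γ] [IsOrderedAddMonoid Γ]

/-- The valuation ring `R_v = {x | 0 ≤ v x}` of a Krull valuation `v`, written additively. It is a
local ring whose maximal ideal is `M_v`. -/
abbrev valuationRing (v : AddValuation K (WithTop Γ)) : ValuationSubring K :=
  (AddValuation.toValuation v).valuationSubring

theorem mem_valuationRing (v : AddValuation K (WithTop Γ)) (x : K) :
    x ∈ valuationRing v ↔ 0 ≤ v x :=
  Iff.rfl

/-- The value group `G_v = v(K \ {0})`. -/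
def valueGroup (v : AddValuation K (WithTop Γ)) : AddSubgroup Γ where
  carrier := {g | ∃ x : K, v x = (g : WithTop Γ)}
  zero_mem' := ⟨1, by simp⟩
  add_mem' := by
    rintro g h ⟨x, hx⟩ ⟨y, hy⟩
    exact ⟨x * y, by rw [v.map_mul, hx, hy, WithTop.coe_add]⟩
  neg_mem' := by
    rintro g ⟨x, hx⟩
    exact ⟨x⁻¹, by rw [v.map_inv, hx]; rfl⟩

/-- The value group, viewed inside the divisible hull of `Γ` (which contains the divisible closure
of `G_v`). -/
def valueGroupHull (v : AddValuation K (WithTop Γ)) : AddSubgroup (DivisibleHull Γ) :=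
  (valueGroup v).map (DivisibleHull.coeAddMonoidHom Γ)

/-- The Gaussian prolongation `v^x` on polynomials: the minimum of the values of the
coefficients (`⊤` for the zero polynomial). -/
def gaussVal (v : AddValuation K (WithTop Γ)) (p : K[X]) : WithTop Γ :=
  p.support.inf fun i => v (p.coeff i)

/-- The value `v^x(p)` as an element of `Γ`; only used for `p ≠ 0`. -/
def gaussValue (v : AddValuation K (WithTop Γ)) (p : K[X]) : Γ :=
  (gaussVal v p).untopD 0

theorem coe_gaussValue (v : AddValuation K (WithTop Γ)) {p : K[X]} (hp : p ≠ 0) :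
    ((gaussValue v p : Γ) : WithTop Γ) = gaussVal v p := by
  suffices h : gaussVal v p ≠ ⊤ by
    unfold gaussValue
    lift gaussVal v p to Γ using h with g
    simp
  rw [gaussVal, ← lt_top_iff_ne_top]
  obtain ⟨i, hi⟩ := Polynomial.support_nonempty.mpr hp
  refine lt_of_le_of_lt (Finset.inf_le hi) ?_
  rw [lt_top_iff_ne_top]
  exact (v.ne_top_iff).mpr (Polynomial.mem_support_iff.mp hi)

/-- `f = ∑_{i ≤ n} a_i φ^i` is the `φ`-expansion of `f`, with last nonzero coefficient `a_n`. -/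
structure IsExpansion (φ f : K[X]) (n : ℕ) (a : ℕ → K[X]) : Prop where
  eq_sum : f = ∑ i ∈ Finset.range (n + 1), a i * φ ^ i
  degree_lt : ∀ i ≤ n, (a i).degree < φ.degree
  leading_ne_zero : a n ≠ 0

/-- `μ_{ij} = (v^x(a_{n-j}) - v^x(a_{n-i})) / (j - i)`, used for `i < j ≤ n` with `a_{n-i}` and
`a_{n-j}` nonzero. -/
def polySlope (v : AddValuation K (WithTop Γ)) (n : ℕ) (a : ℕ → K[X]) (i j : ℕ) : DivisibleHull Γ :=
  ((j : ℚ) - (i : ℚ))⁻¹ •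
    DivisibleHull.coe (gaussValue v (a (n - j)) - gaussValue v (a (n - i)))

/-- The indices `j` over which the minimum of `μ_{ij}` is taken. -/
def candidates (n : ℕ) (a : ℕ → K[X]) (i : ℕ) : Set ℕ :=
  {j | i < j ∧ j ≤ n ∧ a (n - j) ≠ 0}

/-- `i'` is the largest index among the candidates `j` which minimize `μ_{ij}`. -/
def IsNextVertex (v : AddValuation K (WithTop Γ)) (n : ℕ) (a : ℕ → K[X]) (i i' : ℕ) : Prop :=
  IsGreatest {j | j ∈ candidates n a i ∧
    ∀ j' ∈ candidates n a i, polySlope v n a i j ≤ polySlope v n a i j'} i'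

/-- The Newton polygon attached to the expansion with coefficients `a_0, …, a_n` has `q` edges, and
its vertices are the points with indices `0 = w_0 < w_1 < ⋯ < w_q = n`. -/
structure IsNewtonPolygon (v : AddValuation K (WithTop Γ)) (n : ℕ) (a : ℕ → K[X])
    (q : ℕ) (w : ℕ → ℕ) : Prop where
  start : w 0 = 0
  finish : w q = n
  next : ∀ t < q, IsNextVertex v n a (w t) (w (t + 1))

/-- The set of pairs `(i, i')` such that the points with indices `i < i'` are the two vertices of
an edge of positive slope of the Newton polygon. -/
def positiveEdges (v : AddValuation K (WithTop Γ)) (n : ℕ) (a : ℕ → K[X]) : Set (ℕ × ℕ) :=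
  {e | (∃ (q : ℕ) (w : ℕ → ℕ), IsNewtonPolygon v n a q w ∧
      ∃ t < q, w t = e.1 ∧ w (t + 1) = e.2) ∧ 0 < polySlope v n a e.1 e.2}

end KrullNewton

end

/-! Fix an edge of slope `γ = λ_j > 0` and give the term `c Φ^k` of a `Φ`-adic expansion the weight
`v^x(c) + kγ`. Every point of the polygon lies on or above the line through the edge, so the weight
of `f` attains its minimum at two different indices (`IsNewtonPolygon.weight_min`). If two indices
of a polynomial have equal finite weight, their difference times `γ` lies in `G_v`, so the
difference is at least `𝔡_j`. A nonzero factor of degree below `𝔡_j m` therefore has a unique index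
of minimal weight (`exists_unique_min_weight`). Unique minima add under multiplication
(`weight_mul_of_unique_min`), because `φ` is irreducible modulo `M_v` and `γ > 0`. If both factors
were that small, `f` would have a unique minimum, contradicting the edge. So the larger degree is at
least `𝔡_j m` for every `j`, which bounds the smaller one. -/

namespace KrullNewton

/-! ### `Φ`-adic expansions over a field. -/

section AdicCoeff

variable {K : Type*} [Field K] {Φ : K[X]}

theorem add_divModByMonic (hΦ : Φ.Monic) (p q : K[X]) :
    (p + q) /ₘ Φ = p /ₘ Φ + q /ₘ Φ ∧ (p + q) %ₘ Φ = p %ₘ Φ + q %ₘ Φ := by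
  refine div_modByMonic_unique _ _ hΦ ⟨?_, ?_⟩
  · conv_rhs => rw [← modByMonic_add_div p Φ, ← modByMonic_add_div q Φ]
    ring
  · exact (degree_add_le _ _).trans_lt
      (max_lt (degree_modByMonic_lt _ hΦ) (degree_modByMonic_lt _ hΦ))

theorem add_mul_divModByMonic (hΦ : Φ.Monic) {r : K[X]} (hr : r.degree < Φ.degree) (q : K[X]) :
    (r + Φ * q) /ₘ Φ = q ∧ (r + Φ * q) %ₘ Φ = r :=
  div_modByMonic_unique _ _ hΦ ⟨rfl, hr⟩

/-- The coefficient of `Φ ^ i` in the `Φ`-adic expansion of a polynomial. -/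
noncomputable def adicCoeff (Φ : K[X]) : ℕ → K[X] → K[X]
  | 0, p => p %ₘ Φ
  | i + 1, p => adicCoeff Φ i (p /ₘ Φ)

theorem adicCoeff_add (hΦ : Φ.Monic) (i : ℕ) (p q : K[X]) :
    adicCoeff Φ i (p + q) = adicCoeff Φ i p + adicCoeff Φ i q := by
  induction i generalizing p q with
  | zero => exact (add_divModByMonic hΦ p q).2
  | succ i ih => simp only [adicCoeff, (add_divModByMonic hΦ p q).1, ih]

theorem adicCoeff_zero_right (i : ℕ) : adicCoeff Φ i 0 = 0 := by
  induction i with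
  | zero => simp [adicCoeff]
  | succ i ih => simpa [adicCoeff] using ih

theorem degree_adicCoeff_lt (hΦ : Φ.Monic) (i : ℕ) (p : K[X]) :
    (adicCoeff Φ i p).degree < Φ.degree := by
  induction i generalizing p with
  | zero => exact degree_modByMonic_lt _ hΦ
  | succ i ih => exact ih _

theorem adicCoeff_mul_pow (hΦ : Φ.Monic) (p : K[X]) (s k : ℕ) :
    adicCoeff Φ k (p * Φ ^ s) = if k < s then 0 else adicCoeff Φ (k - s) p := by
  induction s generalizing k with
  | zero => simp
  | succ s ih =>
    have h := add_mul_divModByMonic hΦ (r := 0) (by rw [degree_zero, bot_lt_iff_ne_bot, Ne, degree_eq_bot]; exact hΦ.ne_zero)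
      (p * Φ ^ s)
    rw [zero_add, show Φ * (p * Φ ^ s) = p * Φ ^ (s + 1) by ring] at h
    cases k with
    | zero => simp [adicCoeff, h.2]
    | succ k => simp [adicCoeff, h.1, ih]

theorem adicCoeff_of_degree_lt (hΦ : Φ.Monic) {p : K[X]} (hp : p.degree < Φ.degree) (i : ℕ) :
    adicCoeff Φ i p = if i = 0 then p else 0 := by
  cases i with
  | zero => simpa [adicCoeff] using (modByMonic_eq_self_iff hΦ).2 hp
  | succ i => simp [adicCoeff, (divByMonic_eq_zero_iff hΦ).2 hp, adicCoeff_zero_right]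

theorem adicCoeff_sum (hΦ : Φ.Monic) {ι : Type*} (S : Finset ι) (F : ι → K[X]) (k : ℕ) :
    adicCoeff Φ k (∑ i ∈ S, F i) = ∑ i ∈ S, adicCoeff Φ k (F i) :=
  map_sum (AddMonoidHom.mk' (adicCoeff Φ k) (adicCoeff_add hΦ k)) F S

theorem adicCoeff_expansion (hΦ : Φ.Monic) {f : K[X]} {n : ℕ}
    {a : ℕ → K[X]} (ha : IsExpansion Φ f n a) {k : ℕ} (hk : k ≤ n) :
    adicCoeff Φ k f = a k := by
  rw [ha.eq_sum, adicCoeff_sum hΦ, Finset.sum_eq_single k]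
  · rw [adicCoeff_mul_pow hΦ, adicCoeff_of_degree_lt hΦ (ha.degree_lt k hk)]
    simp
  · intro i hi hik
    rw [adicCoeff_mul_pow hΦ,
      adicCoeff_of_degree_lt hΦ (ha.degree_lt i (Nat.lt_succ_iff.1 (Finset.mem_range.1 hi)))]
    split_ifs <;> first | rfl | omega
  · intro h
    exact absurd (Finset.mem_range.2 (Nat.lt_succ_of_le hk)) h

theorem adicCoeff_expansion_of_lt (hΦ : Φ.Monic) {f : K[X]} {n : ℕ}
    {a : ℕ → K[X]} (ha : IsExpansion Φ f n a) {k : ℕ} (hk : n < k) :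
    adicCoeff Φ k f = 0 := by
  rw [ha.eq_sum, adicCoeff_sum hΦ]
  refine Finset.sum_eq_zero fun i hi => ?_
  have hi := Finset.mem_range.1 hi
  rw [adicCoeff_mul_pow hΦ, adicCoeff_of_degree_lt hΦ (ha.degree_lt i (by omega))]
  split_ifs <;> first | rfl | omega

theorem mul_natDegree_le_of_adicCoeff_ne_zero (hΦ : Φ.Monic) {i : ℕ} {p : K[X]}
    (h : adicCoeff Φ i p ≠ 0) : i * Φ.natDegree ≤ p.natDegree := by
  induction i generalizing p with
  | zero => simp
  | succ i ih =>
    have h1 := ih h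
    have hlt : Φ.natDegree ≤ p.natDegree := by
      by_contra! hlt
      apply h
      rw [adicCoeff, (divByMonic_eq_zero_iff hΦ).2 (degree_lt_degree hlt), adicCoeff_zero_right]
    rw [natDegree_divByMonic p hΦ] at h1
    rw [Nat.succ_mul]
    omega

theorem adicCoeff_eq_zero_of_natDegree_lt (hΦ : Φ.Monic) (h0 : 0 < Φ.natDegree) {p : K[X]} {i : ℕ}
    (h : p.natDegree < i) : adicCoeff Φ i p = 0 := by
  by_contra h'
  have := mul_natDegree_le_of_adicCoeff_ne_zero hΦ h'
  nlinarith

theorem sum_adicCoeff (hΦ : Φ.Monic) (h0 : 0 < Φ.natDegree) {N : ℕ} (p : K[X])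
    (hN : p.natDegree < N) : p = ∑ i ∈ Finset.range N, adicCoeff Φ i p * Φ ^ i := by
  induction N generalizing p with
  | zero => omega
  | succ N ih =>
    rw [Finset.sum_range_succ']
    by_cases hp : p /ₘ Φ = 0
    · have hz : ∀ i, adicCoeff Φ (i + 1) p = 0 := fun i => by
        rw [adicCoeff, hp, adicCoeff_zero_right]
      have h := modByMonic_add_div p Φ
      rw [hp, mul_zero, add_zero] at h
      rw [Finset.sum_eq_zero fun i _ => by rw [hz, zero_mul], zero_add, pow_zero, mul_one,
        adicCoeff, h]
    · have hd : Φ.natDegree ≤ p.natDegree := by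
        by_contra! hlt
        exact hp ((divByMonic_eq_zero_iff hΦ).2 (degree_lt_degree hlt))
      have h1 := ih (p /ₘ Φ) (by rw [natDegree_divByMonic p hΦ]; omega)
      calc p = p %ₘ Φ + Φ * (p /ₘ Φ) := (modByMonic_add_div p Φ).symm
        _ = _ := by
          conv_lhs => rw [h1]
          rw [Finset.mul_sum, add_comm]
          congr 1
          · exact Finset.sum_congr rfl fun i _ => by rw [adicCoeff]; ring
          · simp [adicCoeff]

end AdicCoeff

/-! ### The Gauss valuation and division by `φ`. -/

section GaussVal

variable {K Γ : Type*} [Field K] [AddCommGroup Γ] [LinearOrder Γ] [IsOrderedAddMonoid Γ]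
  (v : AddValuation K (WithTop Γ))

theorem le_gaussVal_iff {g : WithTop Γ} {p : K[X]} :
    g ≤ gaussVal v p ↔ ∀ i, g ≤ v (p.coeff i) := by
  rw [gaussVal, Finset.le_inf_iff]
  refine ⟨fun h i => ?_, fun h i _ => h i⟩
  by_cases hi : i ∈ p.support
  · exact h i hi
  · simp [notMem_support_iff.1 hi]

theorem gaussVal_le (p : K[X]) (i : ℕ) : gaussVal v p ≤ v (p.coeff i) :=
  (le_gaussVal_iff v).1 le_rfl i

theorem gaussVal_zero : gaussVal v 0 = ⊤ := by simp [gaussVal]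

theorem min_gaussVal_le_add (p q : K[X]) :
    min (gaussVal v p) (gaussVal v q) ≤ gaussVal v (p + q) := by
  refine (le_gaussVal_iff v).2 fun i => ?_
  rw [coeff_add]
  exact (min_le_min (gaussVal_le v p i) (gaussVal_le v q i)).trans (v.map_add _ _)

theorem le_gaussVal_C_mul_map (c : K) (P : (valuationRing v)[X]) :
    v c ≤ gaussVal v (C c * P.map (algebraMap (valuationRing v) K)) := by
  refine (le_gaussVal_iff v).2 fun i => ?_
  rw [coeff_C_mul, v.map_mul, coeff_map]
  exact le_add_of_nonneg_right ((mem_valuationRing v _).1 (P.coeff i).2)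

theorem map_eq_zero_of_isUnit {u : valuationRing v} (hu : IsUnit u) : v (u : K) = 0 := by
  obtain ⟨w, hw⟩ := hu.exists_right_inv
  have h : v (u : K) + v (w : K) = 0 := by
    rw [← v.map_mul, ← v.map_one]
    exact congrArg v (congrArg Subtype.val hw)
  have h1 := (mem_valuationRing v _).1 u.2
  have h2 := (mem_valuationRing v _).1 w.2
  exact le_antisymm (h ▸ le_add_of_nonneg_right h2) h1

theorem gaussVal_C_mul_map (c : K) {P : (valuationRing v)[X]}
    (hP : P.map (IsLocalRing.residue (valuationRing v)) ≠ 0) :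
    gaussVal v (C c * P.map (algebraMap (valuationRing v) K)) = v c := by
  refine le_antisymm ?_ (le_gaussVal_C_mul_map v c P)
  obtain ⟨i, hi⟩ : ∃ i, (P.map (IsLocalRing.residue (valuationRing v))).coeff i ≠ 0 := by
    by_contra! h
    exact hP (Polynomial.ext fun i => by simpa using h i)
  rw [coeff_map, IsLocalRing.residue_ne_zero_iff_isUnit] at hi
  refine (gaussVal_le v _ i).trans_eq ?_
  rw [coeff_C_mul, v.map_mul, coeff_map]
  erw [map_eq_zero_of_isUnit v hi]
  rw [add_zero]

/-- Dividing by a coefficient of least value makes `p` integral with a coefficient equal to `1`.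
This normalization carries questions about `v^x` to the residue field. -/
theorem exists_eq_C_mul_map {p : K[X]} (hp : p ≠ 0) :
    ∃ c : K, c ≠ 0 ∧ ∃ P : (valuationRing v)[X],
      p = C c * P.map (algebraMap (valuationRing v) K) ∧ v c = gaussVal v p ∧
        P.map (IsLocalRing.residue (valuationRing v)) ≠ 0 := by
  obtain ⟨i, hi, hiv⟩ := Finset.exists_mem_eq_inf p.support (support_nonempty.2 hp)
    fun i => v (p.coeff i)
  have hc : p.coeff i ≠ 0 := mem_support_iff.1 hi
  have hlift : C (p.coeff i)⁻¹ * p ∈ lifts (algebraMap (valuationRing v) K) := by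
    rw [lifts_iff_coeff_lifts]
    intro j
    refine ⟨⟨(C (p.coeff i)⁻¹ * p).coeff j, (mem_valuationRing v _).2 ?_⟩, rfl⟩
    have hj : v (p.coeff i) ≤ v (p.coeff j) := hiv ▸ gaussVal_le v p j
    rw [coeff_C_mul]
    refine WithTop.le_of_add_le_add_left ((v.ne_top_iff).2 hc) ?_
    rw [← v.map_mul, mul_inv_cancel_left₀ hc, add_zero]
    exact hj
  obtain ⟨P, hP⟩ := (mem_lifts _).1 hlift
  refine ⟨p.coeff i, hc, P, ?_, hiv.symm, fun h => ?_⟩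
  · rw [hP, ← mul_assoc, ← C_mul, mul_inv_cancel₀ hc, C_1, one_mul]
  · have h1 : P.coeff i = 1 := by
      have := congrArg (fun q => coeff q i) hP
      simp only [coeff_map, coeff_C_mul, inv_mul_cancel₀ hc] at this
      exact Subtype.ext this
    have := congrArg (fun q => coeff q i) h
    simp [h1] at this

variable {φ : (valuationRing v)[X]}

theorem C_mul_map_divModByMonic (hφ : φ.Monic) (c : K) (P : (valuationRing v)[X]) :
    (C c * P.map (algebraMap (valuationRing v) K)) /ₘ φ.map (algebraMap (valuationRing v) K)
        = C c * (P /ₘ φ).map (algebraMap (valuationRing v) K) ∧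
      (C c * P.map (algebraMap (valuationRing v) K)) %ₘ φ.map (algebraMap (valuationRing v) K)
        = C c * (P %ₘ φ).map (algebraMap (valuationRing v) K) := by
  refine div_modByMonic_unique _ _ (hφ.map _) ⟨?_, ?_⟩
  · conv_rhs => rw [← modByMonic_add_div P φ, Polynomial.map_add, Polynomial.map_mul]
    ring
  · rw [map_modByMonic _ hφ]
    refine lt_of_le_of_lt ?_ (degree_modByMonic_lt
      (P.map (algebraMap (valuationRing v) K)) (hφ.map (algebraMap (valuationRing v) K)))
    rw [← smul_eq_C_mul]
    exact degree_smul_le _ _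

/-- Since `φ` is monic over `R_v`, dividing a normalized polynomial by it never leaves `R_v[x]`. -/
theorem gaussVal_le_adicCoeff (hφ : φ.Monic) (i : ℕ) (p : K[X]) :
    gaussVal v p ≤ gaussVal v (adicCoeff (φ.map (algebraMap (valuationRing v) K)) i p) := by
  induction i generalizing p with
  | zero =>
    rcases eq_or_ne p 0 with rfl | hp
    · rw [adicCoeff_zero_right]
    obtain ⟨c, _, P, hP, hv, _⟩ := exists_eq_C_mul_map v hp
    rw [← hv, hP, adicCoeff, (C_mul_map_divModByMonic v hφ c P).2]
    exact le_gaussVal_C_mul_map v _ _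
  | succ i ih =>
    refine le_trans ?_ (ih _)
    rcases eq_or_ne p 0 with rfl | hp
    · rw [zero_divByMonic]
    obtain ⟨c, _, P, hP, hv, _⟩ := exists_eq_C_mul_map v hp
    rw [← hv, hP, (C_mul_map_divModByMonic v hφ c P).1]
    exact le_gaussVal_C_mul_map v _ _

theorem gaussVal_add_le_mul {p q : K[X]} (hp : p ≠ 0) (hq : q ≠ 0) :
    gaussVal v p + gaussVal v q ≤ gaussVal v (p * q) := by
  obtain ⟨c, _, P, hP, hv, _⟩ := exists_eq_C_mul_map v hp
  obtain ⟨d, _, Q, hQ, hw, _⟩ := exists_eq_C_mul_map v hq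
  rw [← hv, ← hw, ← v.map_mul, hP, hQ, mul_mul_mul_comm, ← C_mul, ← Polynomial.map_mul]
  exact le_gaussVal_C_mul_map v _ _

theorem map_residue_not_dvd (hφ : φ.Monic) {c : K} (hc : c ≠ 0) {P : (valuationRing v)[X]}
    (hP : P.map (IsLocalRing.residue (valuationRing v)) ≠ 0)
    (hdeg : (C c * P.map (algebraMap (valuationRing v) K)).degree
      < (φ.map (algebraMap (valuationRing v) K)).degree) :
    ¬ φ.map (IsLocalRing.residue (valuationRing v)) ∣
      P.map (IsLocalRing.residue (valuationRing v)) := by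
  refine fun h => absurd (degree_le_of_dvd h hP) (not_le.2 ?_)
  rw [degree_C_mul hc, degree_map_eq_of_injective (FaithfulSMul.algebraMap_injective _ _),
    hφ.degree_map] at hdeg
  rw [hφ.degree_map]
  exact degree_map_le.trans_lt hdeg

/-- The reductions of the normalized factors are nonzero of degree below that of the reduction of
`φ`, which is prime. It cannot divide their product, so the remainder does not vanish modulo `M_v`.
-/
theorem gaussVal_mul_modByMonic (hφ : φ.Monic)
    (hirr : Irreducible (φ.map (IsLocalRing.residue (valuationRing v)))) {p q : K[X]}
    (hp : p ≠ 0) (hq : q ≠ 0) (hpd : p.degree < (φ.map (algebraMap (valuationRing v) K)).degree)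
    (hqd : q.degree < (φ.map (algebraMap (valuationRing v) K)).degree) :
    gaussVal v ((p * q) %ₘ φ.map (algebraMap (valuationRing v) K)) =
      gaussVal v p + gaussVal v q := by
  obtain ⟨c, hc, P, rfl, hv, hP⟩ := exists_eq_C_mul_map v hp
  obtain ⟨d, hd, Q, rfl, hw, hQ⟩ := exists_eq_C_mul_map v hq
  rw [← hv, ← hw, ← v.map_mul, mul_mul_mul_comm, ← C_mul, ← Polynomial.map_mul,
    (C_mul_map_divModByMonic v hφ _ _).2]
  refine gaussVal_C_mul_map v _ ?_
  rw [map_modByMonic _ hφ, Ne, modByMonic_eq_zero_iff_dvd (hφ.map _), Polynomial.map_mul,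
    hirr.prime.dvd_mul]
  exact not_or.2 ⟨map_residue_not_dvd v hφ hc hP hpd, map_residue_not_dvd v hφ hd hQ hqd⟩

end GaussVal

/-! ### Weights and their minima under multiplication. -/

section Weight

variable {K Γ : Type*} [Field K] [AddCommGroup Γ] [LinearOrder Γ] [IsOrderedAddMonoid Γ]
  (v : AddValuation K (WithTop Γ))

theorem gaussVal_neg (p : K[X]) : gaussVal v (-p) = gaussVal v p := by
  simp [gaussVal, v.map_neg]

/-- The weight `v^x(c) + k γ` of the term `c Φ ^ k` in the `Φ`-adic expansion of `p`. -/
noncomputable def weight (Φ : K[X]) (γ : DivisibleHull Γ) (k : ℕ) (p : K[X]) : WithTop (DivisibleHull Γ) :=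
  (gaussVal v (adicCoeff Φ k p)).map (DivisibleHull.coeOrderAddMonoidHom Γ) +
    ((k • γ : DivisibleHull Γ) : WithTop (DivisibleHull Γ))

variable {v} {Φ : K[X]} {γ : DivisibleHull Γ}

theorem weight_of_ne_zero {k : ℕ} {p : K[X]} (h : adicCoeff Φ k p ≠ 0) :
    weight v Φ γ k p = ((DivisibleHull.coe (gaussValue v (adicCoeff Φ k p)) + k • γ :
      DivisibleHull Γ) : WithTop (DivisibleHull Γ)) := by
  rw [weight, ← coe_gaussValue v h]
  rfl

theorem weight_eq_top_iff {k : ℕ} {p : K[X]} : weight v Φ γ k p = ⊤ ↔ adicCoeff Φ k p = 0 := by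
  refine ⟨fun h => ?_, fun h => ?_⟩
  · by_contra hp
    rw [weight_of_ne_zero hp] at h
    exact WithTop.coe_ne_top h
  · rw [weight, h, gaussVal_zero]
    rfl

theorem weight_neg (hΦ : Φ.Monic) (k : ℕ) (p : K[X]) :
    weight v Φ γ k (-p) = weight v Φ γ k p := by
  have h : adicCoeff Φ k (-p) = -adicCoeff Φ k p :=
    map_neg (AddMonoidHom.mk' (adicCoeff Φ k) (adicCoeff_add hΦ k)) p
  rw [weight, h, gaussVal_neg, weight]

theorem monotone_map_coe :
    Monotone (WithTop.map (DivisibleHull.coeOrderAddMonoidHom Γ)) :=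
  (DivisibleHull.coeOrderAddMonoidHom Γ).monotone'.withTop_map

theorem lt_weight_add (hΦ : Φ.Monic) {k : ℕ} {p q : K[X]} {W : WithTop (DivisibleHull Γ)}
    (hp : W < weight v Φ γ k p) (hq : W < weight v Φ γ k q) : W < weight v Φ γ k (p + q) := by
  rw [weight, adicCoeff_add hΦ]
  rcases min_le_iff.1 (min_gaussVal_le_add v (adicCoeff Φ k p) (adicCoeff Φ k q)) with h | h
  · exact hp.trans_le (add_le_add_left (monotone_map_coe h) _)
  · exact hq.trans_le (add_le_add_left (monotone_map_coe h) _)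

theorem lt_weight_sum (hΦ : Φ.Monic) {k : ℕ} {ι : Type*} {S : Finset ι} {F : ι → K[X]}
    {W : WithTop (DivisibleHull Γ)} (hW : W < ⊤) (h : ∀ i ∈ S, W < weight v Φ γ k (F i)) :
    W < weight v Φ γ k (∑ i ∈ S, F i) := by
  refine Finset.sum_induction F (fun p => W < weight v Φ γ k p) (fun p q => lt_weight_add hΦ) ?_ h
  rwa [weight_eq_top_iff.2 (adicCoeff_zero_right k)]

theorem mul_natDegree_le_of_weight_eq (hΦ : Φ.Monic) {p : K[X]} {i j D : ℕ} (hij : i < j)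
    (hD : ∀ e : ℕ, 0 < e → e • γ ∈ valueGroupHull v → D ≤ e)
    (hw : weight v Φ γ i p = weight v Φ γ j p) (hfin : weight v Φ γ i p ≠ ⊤) :
    D * Φ.natDegree ≤ p.natDegree := by
  have hi : adicCoeff Φ i p ≠ 0 := fun h => hfin (weight_eq_top_iff.2 h)
  have hj : adicCoeff Φ j p ≠ 0 := fun h => hfin (hw.trans (weight_eq_top_iff.2 h))
  have hmem : ∀ {q : K[X]}, q ≠ 0 → gaussValue v q ∈ valueGroup v := fun {q} hq => by
    obtain ⟨c, _, _, _, hv, _⟩ := exists_eq_C_mul_map v hq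
    exact ⟨c, by rw [hv, coe_gaussValue v hq]⟩
  have hle : D ≤ j - i := by
    refine hD _ (by omega) ⟨_, sub_mem (hmem hi) (hmem hj), ?_⟩
    rw [weight_of_ne_zero hi, weight_of_ne_zero hj, WithTop.coe_inj] at hw
    rw [map_sub]
    change DivisibleHull.coe _ - DivisibleHull.coe _ = _
    rw [sub_eq_iff_eq_add]
    obtain ⟨e, rfl⟩ := Nat.exists_eq_add_of_lt hij
    have he : i + e + 1 - i = e + 1 := by omega
    rw [he]
    rw [show i + e + 1 = (e + 1) + i by ring, add_nsmul, ← add_assoc] at hw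
    rw [add_right_cancel hw, add_comm, show e + 1 + i = i + e + 1 by ring]
  -- The gap `j - i` is at least `D`; only the weaker `D ≤ j` is needed.
  calc D * Φ.natDegree ≤ j * Φ.natDegree := Nat.mul_le_mul_right _ (hle.trans (Nat.sub_le _ _))
    _ ≤ p.natDegree := mul_natDegree_le_of_adicCoeff_ne_zero hΦ hj

theorem exists_unique_min_weight (hΦ : Φ.Monic) (h0 : 0 < Φ.natDegree) {p : K[X]} (hp : p ≠ 0)
    {D : ℕ} (hD : ∀ e : ℕ, 0 < e → e • γ ∈ valueGroupHull v → D ≤ e)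
    (hdeg : p.natDegree < D * Φ.natDegree) :
    ∃ i, ∀ j, j ≠ i → weight v Φ γ i p < weight v Φ γ j p := by
  obtain ⟨i, _, hi⟩ := Finset.exists_min_image (Finset.range (p.natDegree + 1))
    (fun i => weight v Φ γ i p) ⟨0, by simp⟩
  -- Indices beyond the degree carry zero coefficients, hence weight `⊤`.
  have hmin : ∀ j, weight v Φ γ i p ≤ weight v Φ γ j p := fun j => by
    rcases lt_or_ge p.natDegree j with h | h
    · rw [weight_eq_top_iff.2 (adicCoeff_eq_zero_of_natDegree_lt hΦ h0 h)]
      exact le_top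
    · exact hi j (Finset.mem_range.2 (Nat.lt_succ_of_le h))
  have hfin : weight v Φ γ i p ≠ ⊤ := fun h => by
    apply hp
    rw [sum_adicCoeff hΦ h0 p (Nat.lt_succ_self _)]
    refine Finset.sum_eq_zero fun j _ => ?_
    rw [weight_eq_top_iff.1 (top_le_iff.1 (h ▸ hmin j)), zero_mul]
  refine ⟨i, fun j hj => lt_of_le_of_ne (hmin j) fun heq => ?_⟩
  rcases lt_or_gt_of_ne hj with h | h
  · exact hdeg.not_ge (mul_natDegree_le_of_weight_eq hΦ h hD heq.symm (heq ▸ hfin))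
  · exact hdeg.not_ge (mul_natDegree_le_of_weight_eq hΦ h hD heq hfin)

variable {φ : (valuationRing v)[X]}

/-- The remainder of `p * q` has exactly the expected value, and the higher digits have at least
that value. The extra multiples of `γ > 0` make them strictly heavier. -/
theorem le_weight_mul_pow (hφ : φ.Monic)
    (hirr : Irreducible (φ.map (IsLocalRing.residue (valuationRing v)))) (hγ : 0 < γ)
    {p q : K[X]}
    (hp : p ≠ 0) (hq : q ≠ 0) (hpd : p.degree < (φ.map (algebraMap (valuationRing v) K)).degree)
    (hqd : q.degree < (φ.map (algebraMap (valuationRing v) K)).degree) (s k : ℕ) :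
    (k = s → weight v (φ.map (algebraMap (valuationRing v) K)) γ k
        (p * q * φ.map (algebraMap (valuationRing v) K) ^ s) =
      ((DivisibleHull.coe (gaussValue v p) + DivisibleHull.coe (gaussValue v q) + s • γ :
        DivisibleHull Γ) : WithTop (DivisibleHull Γ))) ∧
    (k ≠ s → ((DivisibleHull.coe (gaussValue v p) + DivisibleHull.coe (gaussValue v q) + s • γ :
        DivisibleHull Γ) : WithTop (DivisibleHull Γ)) <
      weight v (φ.map (algebraMap (valuationRing v) K)) γ k
        (p * q * φ.map (algebraMap (valuationRing v) K) ^ s)) := by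
  have hΦ := hφ.map (algebraMap (valuationRing v) K)
  refine ⟨?_, fun hks => ?_⟩
  · rintro rfl
    rw [weight, adicCoeff_mul_pow hΦ, if_neg (lt_irrefl _), Nat.sub_self, adicCoeff,
      gaussVal_mul_modByMonic v hφ hirr hp hq hpd hqd, ← coe_gaussValue v hp,
      ← coe_gaussValue v hq, ← DivisibleHull.coe_add]
    rfl
  · rcases lt_or_gt_of_ne hks with h | h
    · rw [weight_eq_top_iff.2 (by rw [adicCoeff_mul_pow hΦ, if_pos h])]
      exact WithTop.coe_lt_top _
    · have hle := (gaussVal_add_le_mul v hp hq).trans (gaussVal_le_adicCoeff v hφ (k - s) (p * q))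
      rw [← coe_gaussValue v hp, ← coe_gaussValue v hq, ← WithTop.coe_add] at hle
      rw [weight, adicCoeff_mul_pow hΦ, if_neg (not_lt.2 h.le)]
      refine lt_of_lt_of_le ?_ (add_le_add_left (monotone_map_coe hle) _)
      rw [WithTop.map_coe, ← WithTop.coe_add, WithTop.coe_lt_coe, ← DivisibleHull.coe_add]
      exact (add_lt_add_iff_left _).2 (nsmul_lt_nsmul_left hγ h)

theorem weight_mul_of_unique_min (hφ : φ.Monic)
    (hirr : Irreducible (φ.map (IsLocalRing.residue (valuationRing v)))) (hγ : 0 < γ)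
    (h0 : 0 < (φ.map (algebraMap (valuationRing v) K)).natDegree) {p q : K[X]} {i₀ j₀ : ℕ}
    (hp : ∀ i, i ≠ i₀ → weight v (φ.map (algebraMap (valuationRing v) K)) γ i₀ p <
      weight v (φ.map (algebraMap (valuationRing v) K)) γ i p)
    (hq : ∀ j, j ≠ j₀ → weight v (φ.map (algebraMap (valuationRing v) K)) γ j₀ q <
      weight v (φ.map (algebraMap (valuationRing v) K)) γ j q) {k : ℕ} (hk : k ≠ i₀ + j₀) :
    weight v (φ.map (algebraMap (valuationRing v) K)) γ (i₀ + j₀) (p * q) <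
      weight v (φ.map (algebraMap (valuationRing v) K)) γ k (p * q) := by
  have hΦ := hφ.map (algebraMap (valuationRing v) K)
  have key := fun {a b : K[X]} => le_weight_mul_pow (p := a) (q := b) hφ hirr hγ
  set Φ := φ.map (algebraMap (valuationRing v) K)
  have hp0 : adicCoeff Φ i₀ p ≠ 0 := fun h =>
    -- Any index other than `i₀` would do: being strictly below something makes the weight finite.
    (hp (i₀ + 1) (by omega)).ne_top (weight_eq_top_iff.2 h)
  have hq0 : adicCoeff Φ j₀ q ≠ 0 := fun h =>
    (hq (j₀ + 1) (by omega)).ne_top (weight_eq_top_iff.2 h)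
  have hd := degree_adicCoeff_lt hΦ
  set T : ℕ × ℕ → K[X] := fun x =>
    adicCoeff Φ x.1 p * adicCoeff Φ x.2 q * Φ ^ (x.1 + x.2) with hT
  set W : WithTop (DivisibleHull Γ) :=
    ((DivisibleHull.coe (gaussValue v (adicCoeff Φ i₀ p)) +
      DivisibleHull.coe (gaussValue v (adicCoeff Φ j₀ q)) + (i₀ + j₀) • γ : DivisibleHull Γ) :
      WithTop (DivisibleHull Γ)) with hW
  set S := Finset.range (p.natDegree + 1) ×ˢ Finset.range (q.natDegree + 1) with hS
  have hsum : p * q = T (i₀, j₀) + ∑ x ∈ S.erase (i₀, j₀), T x := by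
    rw [Finset.add_sum_erase]
    · conv_lhs => rw [sum_adicCoeff hΦ h0 p (Nat.lt_succ_self _),
        sum_adicCoeff hΦ h0 q (Nat.lt_succ_self _), Finset.sum_mul_sum]
      rw [hS, Finset.sum_product]
      exact Finset.sum_congr rfl fun i _ => Finset.sum_congr rfl fun j _ => by
        rw [hT]; ring
    · rw [hS, Finset.mem_product, Finset.mem_range, Finset.mem_range]
      constructor
      · by_contra h
        exact hp0 (adicCoeff_eq_zero_of_natDegree_lt hΦ h0 (by omega))
      · by_contra h
        exact hq0 (adicCoeff_eq_zero_of_natDegree_lt hΦ h0 (by omega))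
  -- Any other pair has a larger sum of weights, since at least one index is not the minimizer.
  have hrest : ∀ k, W < weight v Φ γ k (∑ x ∈ S.erase (i₀, j₀), T x) := fun k => by
    refine lt_weight_sum hΦ (WithTop.coe_lt_top _) fun x hx => ?_
    have hx := (Finset.mem_erase.1 hx).1
    obtain ⟨i, j⟩ := x
    by_cases hi : adicCoeff Φ i p = 0
    · rw [weight_eq_top_iff.2 (by simp [hT, hi, adicCoeff_zero_right])]
      exact WithTop.coe_lt_top _
    by_cases hj : adicCoeff Φ j q = 0
    · rw [weight_eq_top_iff.2 (by simp [hT, hj, adicCoeff_zero_right])]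
      exact WithTop.coe_lt_top _
    have hle : ((DivisibleHull.coe (gaussValue v (adicCoeff Φ i p)) +
        DivisibleHull.coe (gaussValue v (adicCoeff Φ j q)) + (i + j) • γ : DivisibleHull Γ) :
        WithTop (DivisibleHull Γ)) ≤ weight v Φ γ k (T (i, j)) := by
      by_cases hkij : k = i + j
      · exact ((key hi hj (hd i p) (hd j q) (i + j) k).1 hkij).ge
      · exact ((key hi hj (hd i p) (hd j q) (i + j) k).2 hkij).le
    refine lt_of_lt_of_le ?_ hle
    rw [hW, WithTop.coe_lt_coe, add_nsmul, add_nsmul, add_add_add_comm, add_add_add_comm _ _ (i • γ)]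
    have hpi := hp i
    have hqj := hq j
    rw [weight_of_ne_zero hp0, weight_of_ne_zero hi, WithTop.coe_lt_coe] at hpi
    rw [weight_of_ne_zero hq0, weight_of_ne_zero hj, WithTop.coe_lt_coe] at hqj
    by_cases hii : i = i₀
    · subst hii
      exact (add_lt_add_iff_left _).2 (hqj fun h => hx (by rw [h]))
    · refine add_lt_add_of_lt_of_le (hpi hii) ?_
      by_cases hjj : j = j₀
      · rw [hjj]
      · exact (hqj hjj).le
  have hmain := key hp0 hq0 (hd i₀ p) (hd j₀ q) (i₀ + j₀)
  -- Otherwise subtracting the rest, which is heavier than `W`, would leave the main term heavier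
  -- than `W`.
  have h1 : weight v Φ γ (i₀ + j₀) (p * q) ≤ W := by
    by_contra! hlt
    have h2 := lt_weight_add hΦ hlt (by rw [weight_neg hΦ]; exact hrest (i₀ + j₀))
    rw [hsum, add_neg_cancel_right] at h2
    exact h2.ne ((hmain (i₀ + j₀)).1 rfl).symm
  refine h1.trans_lt ?_
  rw [hsum]
  exact lt_weight_add hΦ ((hmain k).2 hk) (hrest k)

end Weight

/-! ### Convexity of the Newton polygon. -/

section Polygon

variable {K Γ : Type*} [Field K] [AddCommGroup Γ] [LinearOrder Γ] [IsOrderedAddMonoid Γ]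
  {v : AddValuation K (WithTop Γ)} {n : ℕ} {a : ℕ → K[X]}

theorem sub_smul_polySlope {i j : ℕ} (h : i < j) :
    ((j : ℚ) - i) • polySlope v n a i j =
      DivisibleHull.coe (gaussValue v (a (n - j))) -
        DivisibleHull.coe (gaussValue v (a (n - i))) := by
  have hne : ((j : ℚ) - i) ≠ 0 := sub_ne_zero.2 (by exact_mod_cast h.ne')
  rw [polySlope, smul_inv_smul₀ hne]
  exact map_sub (DivisibleHull.coeAddMonoidHom Γ) _ _

theorem IsNextVertex.sub_smul_le {i i' : ℕ} (h : IsNextVertex v n a i i') {j : ℕ} (hij : i < j)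
    (hj : j ≤ n) (haj : a (n - j) ≠ 0) :
    ((j : ℚ) - i) • polySlope v n a i i' ≤
      DivisibleHull.coe (gaussValue v (a (n - j))) -
        DivisibleHull.coe (gaussValue v (a (n - i))) := by
  rw [← sub_smul_polySlope hij]
  exact smul_le_smul_of_nonneg_left (h.1.2 j ⟨hij, hj, haj⟩)
    (sub_nonneg.2 (by exact_mod_cast hij.le))

/-- To the right of the edge's initial vertex this is minimality of the slope; to the left it
follows by induction from the previous edge. -/
theorem IsNewtonPolygon.sub_smul_le {q : ℕ} {w : ℕ → ℕ} (h : IsNewtonPolygon v n a q w) {t : ℕ}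
    (ht : t < q) {i : ℕ} (hi : i ≤ n) (hai : a (n - i) ≠ 0) :
    ((i : ℚ) - w t) • polySlope v n a (w t) (w (t + 1)) ≤
      DivisibleHull.coe (gaussValue v (a (n - i))) -
        DivisibleHull.coe (gaussValue v (a (n - w t))) := by
  induction t generalizing i with
  | zero =>
    rcases Nat.eq_zero_or_pos i with rfl | hpos
    · simp [h.start]
    · exact (h.next 0 ht).sub_smul_le (by rwa [h.start]) hi hai
  | succ t ih =>
    have ht' : t < q := by omega
    rcases lt_or_ge (w (t + 1)) i with hlt | hge
    · exact (h.next _ ht).sub_smul_le hlt hi hai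
    obtain ⟨h1, -, -⟩ := (h.next t ht').1.1
    obtain ⟨h2, h2n, h2a⟩ := (h.next _ ht).1.1
    have e1 := sub_smul_polySlope (v := v) (n := n) (a := a) h1
    have e2 := sub_smul_polySlope (v := v) (n := n) (a := a) h2
    -- The previous edge's line, rebased at its right endpoint.
    have shift : ∀ {j : ℕ}, j ≤ n → a (n - j) ≠ 0 →
        ((j : ℚ) - w (t + 1)) • polySlope v n a (w t) (w (t + 1)) ≤
          DivisibleHull.coe (gaussValue v (a (n - j))) -
            DivisibleHull.coe (gaussValue v (a (n - w (t + 1)))) := fun {j} hj haj => by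
      have h3 := sub_le_sub_right (ih ht' hj haj)
        (((w (t + 1) : ℚ) - w t) • polySlope v n a (w t) (w (t + 1)))
      rw [← sub_smul, sub_sub_sub_cancel_right] at h3
      rwa [e1, sub_sub_sub_cancel_right] at h3
    have hslope : polySlope v n a (w t) (w (t + 1)) ≤
        polySlope v n a (w (t + 1)) (w (t + 1 + 1)) := by
      refine le_of_smul_le_smul_left ((shift h2n h2a).trans_eq e2.symm)
        (sub_pos.2 (by exact_mod_cast h2))
    refine le_trans ?_ (shift hi hai)
    -- Left of the common vertex, the steeper line runs below the previous one.
    exact smul_le_smul_of_nonpos_left hslope (sub_nonpos.2 (by exact_mod_cast hge))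

theorem IsNewtonPolygon.coeff_ne_zero {q : ℕ} {w : ℕ → ℕ} (h : IsNewtonPolygon v n a q w)
    (han : a n ≠ 0) {t : ℕ} (ht : t ≤ q) : a (n - w t) ≠ 0 := by
  cases t with
  | zero => simpa [h.start] using han
  | succ t => exact (h.next t ht).1.1.2.2

variable {Φ f : K[X]}

/-- An edge of the Newton polygon gives two indices at which the weight attains its minimum. -/
theorem IsNewtonPolygon.weight_min {q : ℕ} {w : ℕ → ℕ} (h : IsNewtonPolygon v n a q w)
    (hΦ : Φ.Monic) (ha : IsExpansion Φ f n a) {t : ℕ} (ht : t < q) :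
    w t < w (t + 1) ∧ w (t + 1) ≤ n ∧ ∀ i ∈ ({w t, w (t + 1)} : Set ℕ), ∀ k,
      weight v Φ (polySlope v n a (w t) (w (t + 1))) (n - i) f ≤
        weight v Φ (polySlope v n a (w t) (w (t + 1))) k f := by
  obtain ⟨h1, h1n, h1a⟩ := (h.next t ht).1.1
  refine ⟨h1, h1n, fun i hi k => ?_⟩
  by_cases hk : adicCoeff Φ k f = 0
  · rw [weight_eq_top_iff.2 hk]
    exact le_top
  have hkn : k ≤ n := by
    by_contra! hlt
    exact hk (adicCoeff_expansion_of_lt hΦ ha hlt)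
  have hin : i ≤ n := by rcases hi with rfl | rfl <;> omega
  have hai : a (n - i) ≠ 0 := by
    rcases hi with rfl | rfl
    exacts [h.coeff_ne_zero ha.leading_ne_zero ht.le, h1a]
  have hline : DivisibleHull.coe (gaussValue v (a (n - i))) =
      ((i : ℚ) - w t) • polySlope v n a (w t) (w (t + 1)) +
        DivisibleHull.coe (gaussValue v (a (n - w t))) := by
    rcases hi with rfl | rfl
    · simp
    · rw [sub_smul_polySlope h1, sub_add_cancel]
  -- Abscissa `j` of the polygon belongs to `Φ^(n-j)`, so a slope `γ` along the polygon is cancelled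
  -- by the summand `(n-j)γ` of the weight.
  obtain ⟨j, hj, rfl⟩ : ∃ j ≤ n, k = n - j := ⟨n - k, by omega, by omega⟩
  have e1 := adicCoeff_expansion hΦ ha (Nat.sub_le n i)
  have e2 := adicCoeff_expansion hΦ ha (Nat.sub_le n j)
  rw [e2] at hk
  have hle := h.sub_smul_le ht hj hk
  rw [weight_of_ne_zero (e1 ▸ hai), weight_of_ne_zero (e2 ▸ hk), WithTop.coe_le_coe, e1, e2, hline,
    ← Nat.cast_smul_eq_nsmul ℚ, ← Nat.cast_smul_eq_nsmul ℚ, Nat.cast_sub hin, Nat.cast_sub hj]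
  refine sub_nonneg.1 ((sub_nonneg.2 hle).trans_eq ?_)
  module

end Polygon

end KrullNewton

/-! ### The degree bound for factorizations. -/

open KrullNewton in
theorem mainTheorem2 {K Γ : Type*} [Field K] [AddCommGroup Γ] [LinearOrder Γ]
    [IsOrderedAddMonoid Γ] (v : AddValuation K (WithTop Γ))
    -- `φ` and `f` have coefficients in `R_v`, and `φ` is monic, irreducible modulo `M_v`
    (φ f : (KrullNewton.valuationRing v)[X]) (m : ℕ)
    (hφ_monic : φ.Monic) (hφ_deg : φ.natDegree = m)
    (hφ_irr : Irreducible (φ.map (IsLocalRing.residue (KrullNewton.valuationRing v))))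
    (hφf : ¬ φ ∣ f)
    -- the `φ`-expansion of `f`
    (n : ℕ) (a : ℕ → K[X])
    (ha : KrullNewton.IsExpansion (φ.map (algebraMap (KrullNewton.valuationRing v) K))
      (f.map (algebraMap (KrullNewton.valuationRing v) K)) n a)
    (ha0 : KrullNewton.gaussVal v (a 0) ≠ 0)
    (s : ℕ) (hs : IsLeast {j | j ≤ n ∧ KrullNewton.gaussVal v (a j) = 0} s)
    (hi : ∃ i < s, a i ≠ 0)
    -- the edges of positive slope of the `φ`-Newton polygon of `f`
    (l : ℕ) (k : ℕ → ℕ) (hk0 : k 0 = 0) (hkl : k l = s) (hk : ∀ j < l, k j < k (j + 1))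
    (slopes : ℕ → DivisibleHull Γ)
    (hslopes_anti : ∀ i ∈ Finset.Icc 1 l, ∀ j ∈ Finset.Icc 1 l, i < j → slopes j < slopes i)
    (hedges : KrullNewton.positiveEdges v n a =
      {e | ∃ j ∈ Finset.Icc 1 l, e = (n - k j, n - k (j - 1))})
    (hslopes : ∀ j ∈ Finset.Icc 1 l,
      slopes j = KrullNewton.polySlope v n a (n - k j) (n - k (j - 1)))
    (d : ℕ → ℕ)
    (hd : ∀ j ∈ Finset.Icc 1 l,
      IsLeast {e : ℕ | 0 < e ∧ e • slopes j ∈ KrullNewton.valueGroupHull v} (d j))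
    -- a factorization of `f` over `K`
    (f₁ f₂ : K[X])
    (hf : f.map (algebraMap (KrullNewton.valuationRing v) K) = f₁ * f₂) :
    ((min f₁.natDegree f₂.natDegree : ℕ) : ℤ) ≤
      (f.natDegree : ℤ) - (((Finset.Icc 1 l).sup fun j => d j * m : ℕ) : ℤ) := by
  have hinj := FaithfulSMul.algebraMap_injective (KrullNewton.valuationRing v) K
  have hf0 : f ≠ 0 := fun h => hφf (h ▸ dvd_zero φ)
  have hmul0 : f₁ * f₂ ≠ 0 := by
    rw [← hf]
    exact (Polynomial.map_ne_zero_iff hinj).2 hf0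
  have hdeg : f.natDegree = f₁.natDegree + f₂.natDegree := by
    rw [← natDegree_map_eq_of_injective hinj, hf,
      natDegree_mul (left_ne_zero_of_mul hmul0) (right_ne_zero_of_mul hmul0)]
  have hΦ := hφ_monic.map (algebraMap (valuationRing v) K)
  have hΦm : (φ.map (algebraMap (valuationRing v) K)).natDegree = m := by
    rw [hφ_monic.natDegree_map, hφ_deg]
  have hm : 0 < (φ.map (algebraMap (valuationRing v) K)).natDegree := by
    rw [hφ_monic.natDegree_map, ← hφ_monic.natDegree_map (IsLocalRing.residue (valuationRing v))]
    exact hφ_irr.natDegree_pos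
  -- The degrees add up to `deg f`, so bounding the minimum above is bounding the maximum below.
  suffices h : (Finset.Icc 1 l).sup (fun j => d j * m) ≤ max f₁.natDegree f₂.natDegree by
    omega
  refine Finset.sup_le fun j hj => ?_
  have hedge : (n - k j, n - k (j - 1)) ∈ positiveEdges v n a := by
    rw [hedges]
    exact ⟨j, hj, rfl⟩
  obtain ⟨⟨q, w, hw, t, ht, hwt, hwt'⟩, hpos⟩ := hedge
  obtain ⟨hlt, hn, hmin⟩ := hw.weight_min hΦ ha ht
  dsimp only at hwt hwt' hpos
  rw [← hwt, ← hwt'] at hpos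
  have hD : ∀ e : ℕ, 0 < e → e • polySlope v n a (w t) (w (t + 1)) ∈ valueGroupHull v → d j ≤ e :=
    fun e he hmem => (hd j hj).2 ⟨he, by rwa [hslopes j hj, ← hwt, ← hwt']⟩
  by_contra! hcon
  rw [← hΦm] at hcon
  obtain ⟨i₁, h₁⟩ := exists_unique_min_weight hΦ hm (left_ne_zero_of_mul hmul0) hD
    ((le_max_left _ _).trans_lt hcon)
  obtain ⟨i₂, h₂⟩ := exists_unique_min_weight hΦ hm (right_ne_zero_of_mul hmul0) hD
    ((le_max_right _ _).trans_lt hcon)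
  have hstrict := fun {k : ℕ} => weight_mul_of_unique_min (k := k) hφ_monic hφ_irr hpos hm h₁ h₂
  rw [← hf] at hstrict
  have huniq : ∀ i ∈ ({w t, w (t + 1)} : Set ℕ), n - i = i₁ + i₂ := fun i hi => by
    by_contra hne
    exact (hstrict hne).not_ge (hmin i hi _)
  have u1 := huniq (w t) (by simp)
  have u2 := huniq (w (t + 1)) (by simp)
  -- Both ends of the edge would correspond to the index `i₁ + i₂`, although `w t < w (t + 1) ≤ n`.
  omega
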